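/- Let $\Bbbk$ be a field, let $Q$ be a finite quiver without oriented cycles, let $I$ be a two-sided ideal of the path algebra $\Bbbk Q$, and let $A=\Bbbk Q/I$. Let $B$ be a finite-dimensional associative unital $\Bbbk$-algebra which is self-injective, i.e. the regular module $B_B$ is injective (for finite-dimensional algebras this is equivalent to injectivity of ${}_BB$). Let $M$ be a finite-dimensional $A$-$B$-bimodule (with $\Bbbk$ acting centrally) which is left-right projective, i.e. ${}_AM$ is a projective left $A$-module and $M_B$ is a projective right $B$-module. Then $M$ is projective as an $A$-$B$-bimodule, i.e. as a left module over $A\otimes_{\Bbbk}B^{\mathrm{op}}$. -/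

import Mathlib

open scoped TensorProduct

universe u v w x

/-- A quiver is acyclic if it has no oriented cycles (in particular no loops): every path from a
vertex to itself is the trivial path. -/
def Quiver.IsAcyclic (V : Type v) [Quiver.{w} V] : Prop :=
  ∀ (a : V) (p : Quiver.Path a a), p = Quiver.Path.nil

/-- The type of all (oriented) paths of a quiver, including the trivial path at each vertex.
The path `p` from `a` to `b` is the element `⟨a, b, p⟩`. -/
abbrev Quiver.TotalPath (V : Type v) [Quiver.{w} V] : Type (max v w) :=
  Σ a b : V, Quiver.Path a b

/-- The path algebra of a quiver: its underlying vector space has the paths as a basis. -/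
def PathAlgebra (k : Type u) [Field k] (V : Type v) [Quiver.{w} V] : Type (max u v w) :=
  Quiver.TotalPath V →₀ k

namespace PathAlgebra

noncomputable section

variable {k : Type u} [Field k] {V : Type v} [Quiver.{w} V]

instance : AddCommGroup (PathAlgebra k V) :=
  inferInstanceAs (AddCommGroup (Quiver.TotalPath V →₀ k))

instance : Module k (PathAlgebra k V) :=
  inferInstanceAs (Module k (Quiver.TotalPath V →₀ k))

variable (k V) in
/-- The basis of the path algebra consisting of the paths. -/
def pathBasis : Module.Basis (Quiver.TotalPath V) k (PathAlgebra k V) :=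
  Module.Basis.ofRepr (LinearEquiv.refl k (Quiver.TotalPath V →₀ k))

variable (k) in
/-- The basis element of the path algebra given by a path. -/
def ofPath (x : Quiver.TotalPath V) : PathAlgebra k V := pathBasis k V x

open Classical in
variable (k) in
/-- The product of two paths. Composition is from right to left: the product `p * q` is
"first `q`, then `p`" if `q` ends where `p` starts, and is zero otherwise. -/
def pathMul : Quiver.TotalPath V → Quiver.TotalPath V → PathAlgebra k V
  | ⟨a, b, p⟩, ⟨c, d, q⟩ =>
    if h : a = d then ofPath k ⟨c, b, q.comp (p.cast h rfl)⟩ else 0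

variable (k V) in
/-- The bilinear extension of the product of paths. -/
def mulHom : PathAlgebra k V →ₗ[k] PathAlgebra k V →ₗ[k] PathAlgebra k V :=
  (pathBasis k V).constr k fun x => (pathBasis k V).constr k fun y => pathMul k x y

instance : Mul (PathAlgebra k V) := ⟨fun f g => mulHom k V f g⟩

/-- The unit is the sum of the trivial paths. -/
instance [Fintype V] : One (PathAlgebra k V) :=
  ⟨∑ a : V, ofPath k ⟨a, a, Quiver.Path.nil⟩⟩

theorem mul_def (f g : PathAlgebra k V) : f * g = mulHom k V f g := rfl

theorem one_def [Fintype V] :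
    (1 : PathAlgebra k V) = ∑ a : V, ofPath k ⟨a, a, Quiver.Path.nil⟩ := rfl

theorem mulHom_ofPath (x y : Quiver.TotalPath V) :
    mulHom k V (ofPath k x) (ofPath k y) = pathMul k x y := by
  simp only [mulHom, ofPath, Module.Basis.constr_basis]

theorem pathMul_comp {a b c : V} (p : Quiver.Path b c) (q : Quiver.Path a b) :
    pathMul k ⟨b, c, p⟩ ⟨a, b, q⟩ = ofPath k ⟨a, c, q.comp p⟩ := by
  simp [pathMul]

theorem pathMul_of_ne {a b c d : V} (p : Quiver.Path a b) (q : Quiver.Path c d) (h : a ≠ d) :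
    pathMul k ⟨a, b, p⟩ ⟨c, d, q⟩ = 0 := by
  simp [pathMul, h]

theorem induction_on {P : PathAlgebra k V → Prop} (f : PathAlgebra k V)
    (zero : P 0) (add : ∀ f g, P f → P g → P (f + g)) (smul : ∀ (c : k) f, P f → P (c • f))
    (path : ∀ x, P (ofPath k x)) : P f := by
  have hf : f ∈ Submodule.span k (Set.range (pathBasis k V)) := by
    rw [(pathBasis k V).span_eq]
    exact Submodule.mem_top
  induction hf using Submodule.span_induction with
  | mem f hf =>
    obtain ⟨x, rfl⟩ := hf
    exact path x
  | zero => exact zero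
  | add f g _ _ hf hg => exact add f g hf hg
  | smul c f _ hf => exact smul c f hf

theorem mulHom_assoc (f g h : PathAlgebra k V) :
    mulHom k V (mulHom k V f g) h = mulHom k V f (mulHom k V g h) := by
  induction f using induction_on with
  | zero => simp
  | add f f' hf hf' => simp [hf, hf']
  | smul c f hf => simp [hf]
  | path x =>
  induction g using induction_on with
  | zero => simp
  | add g g' hg hg' => simp [hg, hg']
  | smul c g hg => simp [hg]
  | path y =>
  induction h using induction_on with
  | zero => simp
  | add h h' hh hh' => simp [hh, hh']
  | smul c h hh => simp [hh]
  | path z =>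
  obtain ⟨a, b, p⟩ := x
  obtain ⟨c, d, q⟩ := y
  obtain ⟨e, f, r⟩ := z
  simp only [mulHom_ofPath]
  by_cases h1 : a = d
  · subst h1
    by_cases h2 : c = f
    · subst h2
      simp only [pathMul_comp, mulHom_ofPath, Quiver.Path.comp_assoc]
    · simp only [pathMul_comp, mulHom_ofPath, pathMul_of_ne _ _ h2, map_zero]
  · by_cases h2 : c = f
    · subst h2
      simp only [pathMul_comp, mulHom_ofPath, pathMul_of_ne _ _ h1, map_zero,
        LinearMap.zero_apply]
    · simp only [pathMul_of_ne _ _ h1, pathMul_of_ne _ _ h2, map_zero, LinearMap.zero_apply]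

theorem mulHom_one_left [Fintype V] (f : PathAlgebra k V) : mulHom k V 1 f = f := by
  induction f using induction_on with
  | zero => simp
  | add f f' hf hf' => simp [hf, hf']
  | smul c f hf => simp [hf]
  | path x =>
  obtain ⟨a, b, p⟩ := x
  rw [one_def, map_sum, LinearMap.sum_apply, Finset.sum_eq_single b]
  · rw [mulHom_ofPath, pathMul_comp, Quiver.Path.comp_nil]
  · intro c _ hc
    rw [mulHom_ofPath, pathMul_of_ne _ _ hc]
  · simp

theorem mulHom_one_right [Fintype V] (f : PathAlgebra k V) : mulHom k V f 1 = f := by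
  induction f using induction_on with
  | zero => simp
  | add f f' hf hf' => simp [hf, hf']
  | smul c f hf => simp [hf]
  | path x =>
  obtain ⟨a, b, p⟩ := x
  rw [one_def, map_sum, Finset.sum_eq_single a]
  · rw [mulHom_ofPath, pathMul_comp, Quiver.Path.nil_comp]
  · intro c _ hc
    rw [mulHom_ofPath, pathMul_of_ne _ _ hc.symm]
  · simp

instance [Fintype V] : Ring (PathAlgebra k V) :=
  { (inferInstance : AddCommGroup (PathAlgebra k V)) with
    mul := (· * ·)
    one := 1
    left_distrib := fun f g h => (mulHom k V f).map_add g h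
    right_distrib := fun f g h => (mulHom k V).map_add₂ f g h
    zero_mul := fun f => (mulHom k V).map_zero₂ f
    mul_zero := fun f => (mulHom k V f).map_zero
    mul_assoc := mulHom_assoc
    one_mul := mulHom_one_left
    mul_one := mulHom_one_right }

instance [Fintype V] : Algebra k (PathAlgebra k V) :=
  Algebra.ofModule (fun c f g => (mulHom k V).map_smul₂ c f g)
    (fun c f g => (mulHom k V f).map_smul c g)

end

end PathAlgebra

/-- A finite-dimensional algebra `B` is self-injective if its regular module is injective. For
finite-dimensional algebras, injectivity of the right regular module and injectivity of the left
regular module are equivalent; we use right modules, that is, modules over `Bᵐᵒᵖ`. -/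
def IsSelfInjectiveAlgebra (B : Type x) [Ring B] : Prop :=
  Module.Injective Bᵐᵒᵖ B

section Bimodule

variable (k : Type u) [Field k] (A : Type v) [Ring A] [Algebra k A] (B : Type w) [Ring B]
  [Algebra k B] (M : Type x) [AddCommGroup M] [Module k M] [Module A M] [Module Bᵐᵒᵖ M]

/-- An `A`-`B`-bimodule is left-right projective if it is projective as a left `A`-module and as a
right `B`-module. -/
def IsLeftRightProjective : Prop :=
  Module.Projective A M ∧ Module.Projective Bᵐᵒᵖ M

/-- An `A`-`B`-bimodule (with `k` acting centrally) is projective as a bimodule if it is projective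
as a left module over `A ⊗[k] Bᵐᵒᵖ`, where `(a ⊗ b) m = a m b`. -/
def IsProjectiveBimodule [IsScalarTower k A M] [IsScalarTower k Bᵐᵒᵖ M]
    [SMulCommClass A Bᵐᵒᵖ M] : Prop :=
  letI : Module (A ⊗[k] Bᵐᵒᵖ) M := TensorProduct.Algebra.module
  Module.Projective (A ⊗[k] Bᵐᵒᵖ) M

end Bimodule

/-! Write `C = Bᵐᵒᵖ` and let `e_b` be the image in `A` of the trivial path at `b`. Choose a vertex
`a`, minimal for reachability, with `e_a M ≠ 0`. Since `e_a A e_b ≠ 0` requires a path from `b` to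
`a`, no other `b` with `e_b M ≠ 0` can act into `e_a M`, and `e_a A e_a ⊆ k e_a`. Projectivity over
`A` then makes multiplication `A e_a ⊗ e_a M → M` split injective over `A`
(`exists_section_of_projective`).

Its image `N` is a projective bimodule, because `e_a M` is a `C`-summand of `M`
(`idempotentSpan_projective`). The quotient `M ⧸ N` stays projective on both sides: over `A` because
`N` is a summand, over `C` because `N` is finitely generated projective, hence injective by
self-injectivity (`quotient_projective_right`). Induction on dimension makes `M ⧸ N` a projective
bimodule, so `M ≅ N ⊕ M ⧸ N` is one too (`Module.Projective.of_left_right`). -/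

/-! ### Splittings, projectivity and injectivity over a ring -/

section SplitSequences

variable {R : Type*} [Ring R] {M : Type*} [AddCommGroup M] [Module R M]

/-- A module is projective if a submodule and the corresponding quotient are. -/
theorem Module.Projective.of_submodule_quotient (N : Submodule R M) [Module.Projective R N]
    [Module.Projective R (M ⧸ N)] : Module.Projective R M := by
  obtain ⟨s, hs⟩ := LinearMap.exists_rightInverse_of_surjective N.mkQ N.range_mkQ
  refine .of_lifting_property'' fun f hf => ?_
  obtain ⟨g₁, hg₁⟩ := Module.projective_lifting_property f N.subtype hf
  obtain ⟨g₂, hg₂⟩ := Module.projective_lifting_property f s hf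
  have hs' (m : M) : m - s (N.mkQ m) ∈ N := by
    rw [← Submodule.Quotient.mk_eq_zero, ← Submodule.mkQ_apply, map_sub,
      ← LinearMap.comp_apply N.mkQ s, hs, LinearMap.id_apply, sub_self]
  -- Decompose `m = (m - s [m]) + s [m]` and lift the two summands separately.
  refine ⟨g₁ ∘ₗ (LinearMap.id - s ∘ₗ N.mkQ).codRestrict N hs' + g₂ ∘ₗ N.mkQ, ?_⟩
  ext m
  have h₁ := LinearMap.congr_fun hg₁ ⟨_, hs' m⟩
  have h₂ := LinearMap.congr_fun hg₂ (N.mkQ m)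
  simp only [LinearMap.comp_apply, Submodule.subtype_apply] at h₁ h₂
  simp only [LinearMap.comp_apply, LinearMap.add_apply, map_add, h₂, LinearMap.id_apply]
  erw [h₁]
  simp

/-- If `f : M → P` is surjective and its kernel is the set of fixed points of a retraction `π`,
then `P` is a direct summand of `M`; in particular it is projective if `M` is. -/
theorem Module.Projective.of_surjective_of_retraction {P : Type*} [AddCommGroup P] [Module R P]
    [Module.Projective R M] (f : M →ₗ[R] P) (hf : Function.Surjective f) (π : M →ₗ[R] M)
    (hπ : ∀ m, f (π m) = 0) (hπ' : ∀ m, f m = 0 → π m = m) : Module.Projective R P := by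
  have hker : LinearMap.ker f ≤ LinearMap.ker (LinearMap.id - π) := fun m hm => by
    simp [hπ' m hm]
  -- `id - π` kills `ker f`, so it descends to `P`; it is a section because `f ∘ π = 0`.
  let s : P →ₗ[R] M := (LinearMap.ker f).liftQ (LinearMap.id - π) hker ∘ₗ
    (f.quotKerEquivOfSurjective hf).symm.toLinearMap
  refine .of_split s f ?_
  ext p
  obtain ⟨m, rfl⟩ := hf p
  have : (f.quotKerEquivOfSurjective hf).symm (f m) = Submodule.Quotient.mk m := by
    rw [LinearEquiv.symm_apply_eq]; rfl
  simp [s, this, hπ]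

/-- Over a self-injective ring, finitely generated projective modules are injective: every
injective linear map out of such a module has a retraction. -/
theorem exists_retraction_of_projective (hR : Module.Injective R R)
    {N : Type*} [AddCommGroup N] [Module R N] [Module.Projective R N] [Module.Finite R N]
    (i : N →ₗ[R] M) (hi : Function.Injective i) : ∃ r : M →ₗ[R] N, r ∘ₗ i = .id := by
  -- `N` is a summand of the injective module `Rⁿ`: extend `g` along `i`, then project back by `f`.
  obtain ⟨n, f, g, -, -, hfg⟩ := Module.Finite.exists_comp_eq_id_of_projective R N
  obtain ⟨h, hh⟩ := (Module.Baer.of_injective (Module.Injective.pi R fun _ : Fin n => R)).extension_property i hi g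
  exact ⟨f ∘ₗ h, by rw [LinearMap.comp_assoc, hh, hfg]⟩

end SplitSequences

/-! ### Restriction from `A ⊗ C` to `C` -/

section TensorModule

variable {k : Type*} [Field k] {A : Type*} [Ring A] [Algebra k A] {C : Type*} [Ring C]
  [Algebra k C]

variable (k A C) in
/-- The left multiplication action of the right factor on a tensor product of algebras. -/
@[reducible]
def TensorProduct.rightFactorModule : Module C (A ⊗[k] C) :=
  Module.compHom _ (Algebra.TensorProduct.includeRight : C →ₐ[k] A ⊗[k] C).toRingHom

attribute [local instance] TensorProduct.rightFactorModule

theorem TensorProduct.rightFactorModule_smul_tmul (c : C) (a : A) (c' : C) :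
    c • (a ⊗ₜ[k] c') = a ⊗ₜ[k] (c * c') := by
  change (1 ⊗ₜ[k] c) * (a ⊗ₜ[k] c') = _
  simp

theorem TensorProduct.rightFactorModule_isScalarTower :
    IsScalarTower C (A ⊗[k] C) (A ⊗[k] C) :=
  ⟨fun _ _ _ => mul_assoc _ _ _⟩

attribute [local instance] TensorProduct.rightFactorModule_isScalarTower

theorem TensorProduct.rightFactorModule_projective : Module.Projective C (A ⊗[k] C) := by
  let e : (C ⊗[k] A) ≃ₗ[C] (A ⊗[k] C) :=
    { TensorProduct.comm k C A with
      map_smul' := fun c t => by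
        induction t with
        | zero => simp
        | add x y hx hy =>
          simp only [smul_add, map_add, AddHom.toFun_eq_coe, LinearMap.coe_toAddHom] at *
          rw [hx, hy]
        | tmul x y =>
          simp [TensorProduct.smul_tmul', TensorProduct.rightFactorModule_smul_tmul] }
  exact Module.Projective.of_equiv e

theorem TensorProduct.rightFactorModule_smulCommClass : SMulCommClass A C (A ⊗[k] C) :=
  ⟨fun a c t => by
    induction t with
    | zero => simp
    | add x y hx hy => simp only [smul_add, hx, hy]
    | tmul x y =>
      simp [TensorProduct.smul_tmul', TensorProduct.rightFactorModule_smul_tmul]⟩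

theorem TensorProduct.rightFactorModule_isScalarTower_base : IsScalarTower k C (A ⊗[k] C) :=
  ⟨fun r c t => by
    induction t with
    | zero => simp
    | add x y hx hy => simp only [smul_add, hx, hy]
    | tmul x y => simp [TensorProduct.rightFactorModule_smul_tmul]⟩

variable {M : Type*} [AddCommGroup M] [Module C M] [Module (A ⊗[k] C) M]

theorem TensorProduct.tmul_smul_eq [Module A M] [IsScalarTower A (A ⊗[k] C) M] [IsScalarTower C (A ⊗[k] C) M]
    (a : A) (c : C) (m : M) : (a ⊗ₜ[k] c) • m = a • c • m := by
  have h : a ⊗ₜ[k] c = a • c • (1 : A ⊗[k] C) := by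
    rw [Algebra.TensorProduct.one_def, TensorProduct.rightFactorModule_smul_tmul,
      TensorProduct.smul_tmul']
    simp
  rw [h, smul_assoc, smul_assoc, one_smul]

/-- Projective modules over `A ⊗ C` are projective over `C`. -/
theorem Module.Projective.restrict_rightFactor [IsScalarTower C (A ⊗[k] C) M]
    [Module.Projective (A ⊗[k] C) M] : Module.Projective C M := by
  classical
  obtain ⟨s, hs⟩ := Module.projective_def'.1 ‹Module.Projective (A ⊗[k] C) M›
  have := TensorProduct.rightFactorModule_projective (k := k) (A := A) (C := C)
  have : Module.Projective C (M →₀ A ⊗[k] C) :=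
    .of_equiv (finsuppLequivDFinsupp C (ι := M) (M := A ⊗[k] C)).symm
  exact .of_split (s.restrictScalars C)
    ((Finsupp.linearCombination (A ⊗[k] C) id).restrictScalars C)
    (LinearMap.ext fun m => LinearMap.congr_fun hs m)

end TensorModule

/-! ### Splitting off the sub-bimodule generated by an idempotent part -/

section LocalizingIdempotent

variable {k : Type*} [Field k] {A : Type*} [Ring A] [Algebra k A]

/-- Let `e` be an idempotent with `eAe ⊆ k e` which is one of a finite family `E` of elements with
sum `1`, such that for every other member `E b` either `e A E b` or `E b M` vanishes. If `M` is
projective, then the map `A ⊗ M → M` has a section that sends `e m` to `e ⊗ e m`. -/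
theorem exists_section_of_projective {M : Type*} [AddCommGroup M] [Module k M] [Module A M]
    [IsScalarTower k A M] [Module.Projective A M] {ι : Type*} [Fintype ι] (E : ι → A)
    (hsum : ∑ b, E b = 1) (hidem : ∀ b, E b * E b = E b) (a : ι)
    (hscalar : ∀ x : A, ∃ c : k, E a * x * E a = c • E a)
    (hne : ∀ b, b ≠ a → (∀ x : A, E a * x * E b = 0) ∨ ∀ m : M, E b • m = 0) :
    ∃ s : M →ₗ[A] A ⊗[k] M, ∀ m, s (E a • m) = E a ⊗ₜ[k] (E a • m) := by
  classical
  let act (b : ι) : M →ₗ[k] M :=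
    { toFun := fun m => E b • m
      map_add' := smul_add _
      map_smul' := fun c m => smul_comm _ _ _ }
  let μ : A ⊗[k] M →ₗ[A] M :=
    TensorProduct.AlgebraTensorModule.lift
      (LinearMap.toSpanSingleton A (M →ₗ[k] M) LinearMap.id)
  -- `ρ` pushes tensors into the sum of the `A E_b ⊗ E_b M` without changing their image under `μ`.
  let ρ : A ⊗[k] M →ₗ[A] A ⊗[k] M :=
    TensorProduct.AlgebraTensorModule.lift
      (LinearMap.toSpanSingleton A (M →ₗ[k] A ⊗[k] M)
        (∑ b, TensorProduct.mk k A M (E b) ∘ₗ act b))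
  have hμ (u : A) (m : M) : μ (u ⊗ₜ m) = u • m := by simp [μ]
  have hρ (u : A) (m : M) : ρ (u ⊗ₜ m) = ∑ b, (u * E b) ⊗ₜ[k] (E b • m) := by
    simp [ρ, act, Finset.smul_sum, TensorProduct.smul_tmul']
  have hμρ (t : A ⊗[k] M) : μ (ρ t) = μ t := by
    induction t with
    | zero => simp
    | add x y hx hy => simp [hx, hy]
    | tmul u m =>
      simp only [hρ, map_sum, hμ, ← mul_smul, mul_assoc, hidem]
      rw [← Finset.sum_smul, ← Finset.mul_sum, hsum, mul_one]
  have hρe (t : A ⊗[k] M) : ∃ m, E a • ρ t = E a ⊗ₜ[k] (E a • m) := by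
    induction t with
    | zero => exact ⟨0, by simp⟩
    | add x y hx hy =>
      obtain ⟨m, hm⟩ := hx
      obtain ⟨n, hn⟩ := hy
      exact ⟨m + n, by rw [map_add, smul_add, hm, hn, smul_add, TensorProduct.tmul_add]⟩
    | tmul u m =>
      obtain ⟨c, hc⟩ := hscalar u
      refine ⟨c • m, ?_⟩
      rw [hρ, Finset.smul_sum, Finset.sum_eq_single a]
      · rw [TensorProduct.smul_tmul', smul_eq_mul, ← mul_assoc, hc, TensorProduct.smul_tmul,
          smul_comm]
      · intro b _ hb
        rw [TensorProduct.smul_tmul', smul_eq_mul, ← mul_assoc]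
        rcases hne b hb with h | h
        · rw [h, TensorProduct.zero_tmul]
        · rw [h, TensorProduct.tmul_zero]
      · simp
  obtain ⟨s, hs⟩ := Module.projective_lifting_property μ LinearMap.id
    (fun m => ⟨1 ⊗ₜ m, by rw [hμ, one_smul]⟩)
  refine ⟨ρ ∘ₗ s, fun m => ?_⟩
  -- Idempotency puts the value at `E a • m` in the form `E a ⊗ E a m'`; applying `μ` identifies `E
  -- a m'` with `E a m`.
  obtain ⟨m', hm'⟩ := hρe (s (E a • m))
  have h : (ρ ∘ₗ s) (E a • m) = E a ⊗ₜ[k] (E a • m') := by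
    rw [← hm', LinearMap.comp_apply, ← map_smul, ← map_smul, ← mul_smul, hidem]
  have h' := congr_arg μ h
  rw [LinearMap.comp_apply, hμρ, ← LinearMap.comp_apply, hs, hμ, ← mul_smul, hidem,
    LinearMap.id_apply] at h'
  rw [h, h']

variable {C : Type*} [Ring C] [Algebra k C]

attribute [local instance] TensorProduct.rightFactorModule
  TensorProduct.rightFactorModule_isScalarTower
  TensorProduct.rightFactorModule_smulCommClass
  TensorProduct.rightFactorModule_isScalarTower_base


variable (k C) in
/-- The sub-bimodule of `M` generated by `e M`. -/
def idempotentSpan (M : Type*) [AddCommGroup M] [Module A M] [Module (A ⊗[k] C) M] (e : A) :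
    Submodule (A ⊗[k] C) M :=
  Submodule.span (A ⊗[k] C) (Set.range fun m : M => e • m)

theorem smul_mem_idempotentSpan {M : Type*} [AddCommGroup M] [Module A M] [Module (A ⊗[k] C) M]
    (e : A) (m : M) : e • m ∈ idempotentSpan k C M e :=
  Submodule.subset_span ⟨m, rfl⟩

/-- A `C`-linear map `h` from `M` to a bimodule with values in the `e`-part extends from `e M` to
the sub-bimodule generated by `e M`, provided that there is a section as in
`exists_section_of_projective`. -/
theorem exists_extension_idempotentSpan {M : Type*} [AddCommGroup M] [Module k M] [Module A M]
    [Module C M] [Module (A ⊗[k] C) M] [IsScalarTower k C M] [IsScalarTower A (A ⊗[k] C) M]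
    [IsScalarTower C (A ⊗[k] C) M] [SMulCommClass A C M] {e : A} (s : M →ₗ[A] A ⊗[k] M)
    (hs : ∀ m, s (e • m) = e ⊗ₜ[k] (e • m))
    {X : Type*} [AddCommGroup X] [Module k X] [Module A X] [Module C X] [Module (A ⊗[k] C) X]
    [IsScalarTower k A X] [IsScalarTower k C X] [IsScalarTower A (A ⊗[k] C) X]
    [IsScalarTower C (A ⊗[k] C) X] (h : M →ₗ[C] X) (hh : ∀ m, e • h (e • m) = h m) :
    ∃ H : M →ₗ[A] X, (∀ m, H (e • m) = h m) ∧
      ∀ n ∈ idempotentSpan k C M e, ∀ r : A ⊗[k] C, H (r • n) = r • H n := by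
  let H : M →ₗ[A] X := TensorProduct.AlgebraTensorModule.lift
      (LinearMap.toSpanSingleton A (M →ₗ[k] X) (h.restrictScalars k)) ∘ₗ s
  have hH (m : M) : H (e • m) = h m := by
    rw [LinearMap.comp_apply, hs]
    simp [hh]
  -- `s` is only `A`-linear, but on `e M` the map `H` agrees with the `C`-linear `h`, and `C`
  -- preserves `e M`.
  have hHr (r : A ⊗[k] C) (m : M) : H (r • e • m) = r • h m := by
    induction r with
    | zero => simp
    | add x y hx hy => simp only [add_smul, map_add, hx, hy]
    | tmul a c =>
      rw [TensorProduct.tmul_smul_eq, TensorProduct.tmul_smul_eq, map_smul, ← smul_comm e c m, hH,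
        map_smul]
  refine ⟨H, hH, fun n hn => ?_⟩
  induction hn using Submodule.span_induction with
  | mem n hn =>
    obtain ⟨m, rfl⟩ := hn
    intro r
    rw [hHr, hH]
  | zero => simp
  | add x y _ _ hx hy => intro r; rw [smul_add, map_add, hx, hy, map_add, smul_add]
  | smul r' n _ hn => intro r; rw [← mul_smul, hn, hn, mul_smul]

/-- The sub-bimodule generated by `e M` is projective if `M` is projective over `C`. -/
theorem idempotentSpan_projective {M : Type*} [AddCommGroup M] [Module k M] [Module A M]
    [Module C M] [Module (A ⊗[k] C) M] [IsScalarTower k C M] [IsScalarTower A (A ⊗[k] C) M]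
    [IsScalarTower C (A ⊗[k] C) M] [SMulCommClass A C M] [Module.Projective C M] {e : A}
    (he : e * e = e)
    (s : M →ₗ[A] A ⊗[k] M) (hs : ∀ m, s (e • m) = e ⊗ₜ[k] (e • m)) :
    Module.Projective (A ⊗[k] C) (idempotentSpan k C M e) := by
  refine .of_lifting_property'' fun f hf => ?_
  let N := idempotentSpan k C M e
  let g : M →ₗ[C] N :=
    { toFun := fun m => ⟨e • m, smul_mem_idempotentSpan e m⟩
      map_add' := fun x y => Subtype.ext (smul_add _ _ _)
      map_smul' := fun c x => Subtype.ext (smul_comm _ _ _) }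
  obtain ⟨h₀, hh₀⟩ := Module.projective_lifting_property (f.restrictScalars C) g hf
  -- Multiplying by `e` on both sides makes the `C`-linear lift land in the `e`-part, as the
  -- extension requires.
  let h : M →ₗ[C] (N →₀ A ⊗[k] C) :=
    { toFun := fun m => e • h₀ (e • m)
      map_add' := fun x y => by simp only [smul_add, map_add]
      map_smul' := fun c x => by
        rw [smul_comm e c x, map_smul, smul_comm e c, RingHom.id_apply] }
  have hh (m : M) : e • h (e • m) = h m := by
    change e • e • h₀ (e • e • m) = e • h₀ (e • m)
    simp only [← mul_smul, he]
  obtain ⟨H, hH, hHr⟩ := exists_extension_idempotentSpan s hs h hh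
  let σ : N →ₗ[A ⊗[k] C] (N →₀ A ⊗[k] C) :=
    { toFun := fun n => H n
      map_add' := fun x y => H.map_add x y
      map_smul' := fun r n => hHr n n.2 r }
  refine ⟨σ, ?_⟩
  have key (m : M) : f (H (e • m)) = ⟨e • m, smul_mem_idempotentSpan e m⟩ := by
    rw [hH]
    change (f.restrictScalars A) (e • h₀ (e • m)) = _
    rw [map_smul]
    have := LinearMap.congr_fun hh₀ (e • m)
    simp only [LinearMap.comp_apply, LinearMap.restrictScalars_apply] at this ⊢
    rw [this]
    apply Subtype.ext
    change e • e • e • m = e • m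
    simp only [← mul_smul, he]
  have hsub (n : M) (hn : n ∈ N) : (f (H n) : M) = n := by
    -- Membership is carried along because `hHr` applies only on `N`.
    suffices n ∈ N ∧ (f (H n) : M) = n from this.2
    induction hn using Submodule.span_induction with
    | mem n hn =>
      obtain ⟨m, rfl⟩ := hn
      exact ⟨smul_mem_idempotentSpan e m, by simp only [key]⟩
    | zero => simp
    | add x y _ _ hx hy => exact ⟨N.add_mem hx.1 hy.1, by simp [hx.2, hy.2]⟩
    | smul r n _ hn => exact ⟨N.smul_mem r hn.1, by rw [hHr n hn.1 r]; simp [hn.2]⟩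
  exact LinearMap.ext fun n => Subtype.ext (hsub n n.2)

/-- The quotient of `M` by the sub-bimodule generated by `e M` is projective over `A` if `M` is. -/
theorem quotient_idempotentSpan_projective_left {M : Type*} [AddCommGroup M] [Module k M]
    [Module A M] [Module C M] [Module (A ⊗[k] C) M] [IsScalarTower k A M] [IsScalarTower k C M]
    [IsScalarTower k (A ⊗[k] C) M] [IsScalarTower A (A ⊗[k] C) M] [IsScalarTower C (A ⊗[k] C) M]
    [SMulCommClass A C M] [Module.Projective A M] {e : A} (he : e * e = e)
    (s : M →ₗ[A] A ⊗[k] M) (hs : ∀ m, s (e • m) = e ⊗ₜ[k] (e • m)) :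
    Module.Projective A (M ⧸ idempotentSpan k C M e) := by
  let N := idempotentSpan k C M e
  let h : M →ₗ[C] N :=
    { toFun := fun m => ⟨e • m, smul_mem_idempotentSpan e m⟩
      map_add' := fun x y => Subtype.ext (smul_add _ _ _)
      map_smul' := fun c x => Subtype.ext (smul_comm _ _ _) }
  have hh (m : M) : e • h (e • m) = h m := by
    apply Subtype.ext
    change e • e • e • m = e • m
    simp only [← mul_smul, he]
  -- Extending `m ↦ e m` itself yields an `A`-linear retraction of `M` onto `N`.
  obtain ⟨H, hH, hHr⟩ := exists_extension_idempotentSpan s hs h hh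
  have hsub (n : M) (hn : n ∈ N) : (H n : M) = n := by
    suffices n ∈ N ∧ (H n : M) = n from this.2
    induction hn using Submodule.span_induction with
    | mem n hn =>
      obtain ⟨m, rfl⟩ := hn
      exact ⟨smul_mem_idempotentSpan e m, by simp only [hH]; rfl⟩
    | zero => simp
    | add x y _ _ hx hy => exact ⟨N.add_mem hx.1 hy.1, by simp [hx.2, hy.2]⟩
    | smul r n _ hn => exact ⟨N.smul_mem r hn.1, by rw [hHr n hn.1 r]; simp [hn.2]⟩
  refine .of_surjective_of_retraction (N.mkQ.restrictScalars A) N.mkQ_surjective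
    (N.subtype.restrictScalars A ∘ₗ H) (fun m => ?_) (fun m hm => ?_)
  · exact (Submodule.Quotient.mk_eq_zero N).2 (H m).2
  · exact hsub m ((Submodule.Quotient.mk_eq_zero N).1 hm)

/-- If `C` is a self-injective finite-dimensional algebra, then the quotient of a `C`-projective
finite-dimensional bimodule by a projective sub-bimodule is projective over `C`. -/
theorem quotient_projective_right (hC : Module.Injective C C) {M : Type*} [AddCommGroup M]
    [Module k M] [Module C M] [Module (A ⊗[k] C) M] [IsScalarTower k C M]
    [IsScalarTower k (A ⊗[k] C) M] [IsScalarTower C (A ⊗[k] C) M] [Module.Finite k M]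
    [Module.Projective C M] (N : Submodule (A ⊗[k] C) M) [Module.Projective (A ⊗[k] C) N] :
    Module.Projective C (M ⧸ N) := by
  have : Module.Projective C N := .restrict_rightFactor (k := k) (A := A)
  have : Module.Finite k N := inferInstanceAs (Module.Finite k (N.restrictScalars k))
  have : Module.Finite C N := .of_restrictScalars_finite k C N
  obtain ⟨r, hr⟩ := exists_retraction_of_projective hC (N.subtype.restrictScalars C)
    N.subtype_injective
  refine .of_surjective_of_retraction (N.mkQ.restrictScalars C) N.mkQ_surjective
    (N.subtype.restrictScalars C ∘ₗ r) (fun m => ?_) (fun m hm => ?_)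
  · exact (Submodule.Quotient.mk_eq_zero N).2 (r m).2
  · exact congr_arg Subtype.val
      (LinearMap.congr_fun hr ⟨m, (Submodule.Quotient.mk_eq_zero N).1 hm⟩)

/-- Let `A` be an algebra with a finite family of idempotents `E`, indexed by a partially ordered
set, with sum `1`, such that `E a A E b = 0` unless `b ≤ a`, and `E a A E a ⊆ k (E a)`. Let `C` be a
self-injective algebra. Then a finite-dimensional `A ⊗ C`-module is projective if it is projective
over both `A` and `C`. -/
theorem Module.Projective.of_left_right {ι : Type*} [Fintype ι] [PartialOrder ι] (E : ι → A)
    (hsum : ∑ b, E b = 1) (hidem : ∀ b, E b * E b = E b)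
    (hscalar : ∀ (a : ι) (x : A), ∃ c : k, E a * x * E a = c • E a)
    (hle : ∀ (a b : ι) (x : A), ¬ b ≤ a → E a * x * E b = 0)
    (hC : Module.Injective C C) {M : Type*} [AddCommGroup M] [Module k M] [Module A M]
    [Module C M] [Module (A ⊗[k] C) M] [IsScalarTower k A M] [IsScalarTower k C M]
    [IsScalarTower k (A ⊗[k] C) M] [IsScalarTower A (A ⊗[k] C) M]
    [IsScalarTower C (A ⊗[k] C) M] [SMulCommClass A C M] [Module.Finite k M]
    [Module.Projective A M] [Module.Projective C M] : Module.Projective (A ⊗[k] C) M := by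
  induction hn : Module.finrank k M using Nat.strong_induction_on generalizing M with
  | _ n ih =>
  rcases subsingleton_or_nontrivial M with hM | hM
  · infer_instance
  have hS : {b : ι | ∃ m : M, E b • m ≠ 0}.Nonempty := by
    by_contra hS
    simp only [Set.not_nonempty_iff_eq_empty, Set.eq_empty_iff_forall_notMem, Set.mem_ofPred_eq,
      not_exists, not_not] at hS
    obtain ⟨m, hm⟩ := exists_ne (0 : M)
    apply hm
    rw [← one_smul A m, ← hsum, Finset.sum_smul]
    exact Finset.sum_eq_zero fun b _ => hS b m
  -- Minimality excludes `b ≤ a` for every other `b` with `E b M ≠ 0`, so `hle` kills `E a A E b`.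
  obtain ⟨a, ha⟩ := (Set.toFinite _).exists_minimal hS
  obtain ⟨m, hm⟩ := ha.prop
  obtain ⟨s, hs⟩ := exists_section_of_projective (k := k) (M := M) E hsum hidem a (hscalar a)
    (fun b hb => by
      by_cases hb' : ∃ m : M, E b • m ≠ 0
      · exact .inl fun x => hle a b x fun hba => hb (ha.eq_of_le hb' hba)
      · exact .inr fun m => by simpa using not_exists.1 hb' m)
  let N := idempotentSpan k C M (E a)
  have : Module.Projective (A ⊗[k] C) N := idempotentSpan_projective (hidem a) s hs
  have : Module.Projective A (M ⧸ N) := quotient_idempotentSpan_projective_left (hidem a) s hs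
  have : Module.Projective C (M ⧸ N) := quotient_projective_right hC N
  have hfin : Module.Finite k (M ⧸ N) :=
    inferInstanceAs (Module.Finite k (M ⧸ N.restrictScalars k))
  have hlt : Module.finrank k (M ⧸ N) < n := by
    have h := (N.restrictScalars k).finrank_quotient_add_finrank
    have h' : 0 < Module.finrank k (N.restrictScalars k) := by
      have : Nontrivial (N.restrictScalars k) :=
        ⟨⟨E a • m, smul_mem_idempotentSpan _ m⟩, 0, fun h => hm (congr_arg Subtype.val h)⟩
      exact Module.finrank_pos
    have h'' : Module.finrank k (M ⧸ N) = Module.finrank k (M ⧸ N.restrictScalars k) := rfl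
    omega
  have : Module.Projective (A ⊗[k] C) (M ⧸ N) := ih _ hlt rfl
  exact .of_submodule_quotient N

end LocalizingIdempotent

/-! ### Vertex idempotents and the reachability order -/

namespace PathAlgebra

variable {k : Type*} [Field k] {V : Type*} [Quiver V]

theorem ofPath_mul_ofPath (x y : Quiver.TotalPath V) :
    ofPath k x * ofPath k y = pathMul k x y :=
  mulHom_ofPath x y

/-- The idempotent of the path algebra given by a vertex. -/
noncomputable def vertex (k : Type*) [Field k] {V : Type*} [Quiver V] (a : V) :
    PathAlgebra k V :=
  ofPath k ⟨a, a, Quiver.Path.nil⟩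

theorem vertex_mul_vertex (a : V) : vertex k a * vertex k a = vertex k a := by
  rw [vertex, ofPath_mul_ofPath, pathMul_comp, Quiver.Path.comp_nil]

variable [Fintype V]

/-- The space `e_a (k Q) e_b` consists of the combinations of paths from `b` to `a`. -/
theorem vertex_mul_mul_vertex_mem (a b : V) (f : PathAlgebra k V) :
    vertex k a * f * vertex k b ∈
      Submodule.span k (Set.range fun p : Quiver.Path b a => ofPath k ⟨b, a, p⟩) := by
  induction f using induction_on with
  | zero => simp
  | add f g hf hg => rw [mul_add, add_mul]; exact add_mem hf hg
  | smul c f hf =>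
    rw [mul_smul_comm, smul_mul_assoc]; exact Submodule.smul_mem _ c hf
  | path x =>
    obtain ⟨c, d, p⟩ := x
    rw [vertex, vertex, ofPath_mul_ofPath]
    by_cases had : a = d
    · subst had
      rw [pathMul_comp, ofPath_mul_ofPath]
      by_cases hcb : c = b
      · subst hcb
        rw [pathMul_comp]
        exact Submodule.subset_span ⟨_, rfl⟩
      · rw [pathMul_of_ne _ _ hcb]
        exact zero_mem _
    · rw [pathMul_of_ne _ _ had, zero_mul]
      exact zero_mem _

theorem vertex_mul_mul_vertex_eq_zero {a b : V} (hab : IsEmpty (Quiver.Path b a))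
    (f : PathAlgebra k V) : vertex k a * f * vertex k b = 0 := by
  have h := vertex_mul_mul_vertex_mem a b f
  rwa [Set.range_eq_empty, Submodule.span_empty, Submodule.mem_bot] at h

/-- By acyclicity, the trivial path is the only path from `a` to itself. -/
theorem exists_vertex_mul_mul_vertex_eq_smul (hQ : Quiver.IsAcyclic V) (a : V)
    (f : PathAlgebra k V) : ∃ c : k, vertex k a * f * vertex k a = c • vertex k a := by
  have h := vertex_mul_mul_vertex_mem a a f
  have hr : (Set.range fun p : Quiver.Path a a => ofPath k ⟨a, a, p⟩) ⊆ {vertex k a} := by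
    rintro _ ⟨p, rfl⟩
    rw [hQ a p]
    rfl
  obtain ⟨c, hc⟩ := Submodule.mem_span_singleton.1 (Submodule.span_mono hr h)
  exact ⟨c, hc.symm⟩

end PathAlgebra

/-- The reachability order on the vertices of an acyclic quiver. -/
@[reducible]
def Quiver.IsAcyclic.partialOrder {V : Type*} [Quiver V] (hQ : Quiver.IsAcyclic V) :
    PartialOrder V where
  le a b := Nonempty (Quiver.Path a b)
  le_refl _ := ⟨Quiver.Path.nil⟩
  le_trans _ _ _ := fun ⟨p⟩ ⟨q⟩ => ⟨p.comp q⟩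
  le_antisymm a b := fun ⟨p⟩ ⟨q⟩ => by
    have h := congr_arg Quiver.Path.length (hQ a (p.comp q))
    rw [Quiver.Path.length_comp, Quiver.Path.length_nil] at h
    exact Quiver.Path.eq_of_length_zero p (by omega)

/-- If the right regular module of `B` is injective, so is the left regular module of `Bᵐᵒᵖ`. -/
theorem IsSelfInjectiveAlgebra.injective_op {B : Type*} [Ring B] (hB : IsSelfInjectiveAlgebra B) :
    Module.Injective Bᵐᵒᵖ Bᵐᵒᵖ := by
  let e : B ≃ₗ[Bᵐᵒᵖ] Bᵐᵒᵖ :=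
    { MulOpposite.opAddEquiv with map_smul' := fun _ _ => rfl }
  exact ((Module.Baer.of_injective hB).of_equiv e).injective

attribute [local instance] TensorProduct.rightFactorModule

theorem theorem7p1 {k : Type*} [Field k]
    {V : Type*} [Quiver V] [Fintype V] [∀ a b : V, Finite (a ⟶ b)]
    (hQ : Quiver.IsAcyclic V) (I : TwoSidedIdeal (PathAlgebra k V))
    {A : Type*} [Ring A] [Algebra k A] (e : A ≃ₐ[k] I.ringCon.Quotient)
    {B : Type*} [Ring B] [Algebra k B] [FiniteDimensional k B]
    (hB : IsSelfInjectiveAlgebra B)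
    {M : Type*} [AddCommGroup M] [Module k M] [FiniteDimensional k M]
    [Module A M] [Module Bᵐᵒᵖ M] [IsScalarTower k A M] [IsScalarTower k Bᵐᵒᵖ M]
    [SMulCommClass A Bᵐᵒᵖ M]
    (hM : IsLeftRightProjective A B M) :
    IsProjectiveBimodule k A B M := by
  let : Module (A ⊗[k] Bᵐᵒᵖ) M := TensorProduct.Algebra.module
  let := hQ.partialOrder
  have := hM.1
  have := hM.2
  have hzero (m : M) : (0 : A ⊗[k] Bᵐᵒᵖ) • m = 0 := zero_smul (A ⊗[k] Bᵐᵒᵖ) m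
  have hsmul (a : A) (c : Bᵐᵒᵖ) (m : M) : (a ⊗ₜ[k] c) • m = a • c • m :=
    TensorProduct.Algebra.smul_def a c m
  have : IsScalarTower A (A ⊗[k] Bᵐᵒᵖ) M := ⟨fun a t m => by
    induction t with
    | zero => rw [smul_zero, hzero, smul_zero]
    | add x y hx hy => simp only [smul_add, add_smul, hx, hy]
    | tmul x y => rw [TensorProduct.smul_tmul', hsmul, hsmul, smul_assoc]⟩
  have : IsScalarTower Bᵐᵒᵖ (A ⊗[k] Bᵐᵒᵖ) M := ⟨fun c t m => by
    induction t with
    | zero => rw [smul_zero, hzero, smul_zero]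
    | add x y hx hy => simp only [smul_add, add_smul, hx, hy]
    | tmul x y =>
      rw [TensorProduct.rightFactorModule_smul_tmul, hsmul, hsmul, mul_smul, smul_comm x c]⟩
  have : IsScalarTower k (A ⊗[k] Bᵐᵒᵖ) M := ⟨fun c t m => by
    induction t with
    | zero => rw [smul_zero, hzero, smul_zero]
    | add x y hx hy => simp only [smul_add, add_smul, hx, hy]
    | tmul x y => rw [TensorProduct.smul_tmul', hsmul, hsmul, smul_assoc]⟩
  let π : PathAlgebra k V →ₐ[k] A := e.symm.toAlgHom.comp (I.ringCon.mkₐ k)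
  have hπ : Function.Surjective π := e.symm.surjective.comp Quotient.mk_surjective
  -- All conditions on the vertex idempotents pass along the surjection `π`, so `I` may be
  -- arbitrary; some images may even vanish.
  refine Module.Projective.of_left_right (fun a => π (PathAlgebra.vertex k a)) ?_ (fun a => ?_)
    (fun a x => ?_) (fun a b x hab => ?_) hB.injective_op
  · rw [← map_sum, ← map_one π]
    rfl
  · rw [← map_mul, PathAlgebra.vertex_mul_vertex]
  · obtain ⟨f, rfl⟩ := hπ x
    obtain ⟨c, hc⟩ := PathAlgebra.exists_vertex_mul_mul_vertex_eq_smul hQ a f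
    exact ⟨c, by rw [← map_mul, ← map_mul, hc, map_smul]⟩
  · obtain ⟨f, rfl⟩ := hπ x
    rw [← map_mul, ← map_mul,
      PathAlgebra.vertex_mul_mul_vertex_eq_zero (not_nonempty_iff.1 hab), map_zero]
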